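/- **Theorem 6.1.** Let $S$ be a pomonoid, that is, a monoid with a partial order such that $s\le t$ implies $su\le tu$ and $us\le ut$ for all $s,t,u\in S$. A *left $S$-poset* is a non-empty partially ordered set $A$ with a left action of the monoid $S$ such that $a\le b$ implies $sa\le sb$, and $s\le t$ implies $sa\le ta$, for all $s,t\in S$ and $a,b\in A$. Left $S$-posets form a category whose morphisms are the maps that preserve both the action and the order. A class $\mathcal C$ of left $S$-posets is *axiomatisable* if there is a set $\Pi$ of sentences of the first-order language with equality, a binary relation symbol $\le$, and a unary function symbol for the action of each $s\in S$, such that a left $S$-poset belongs to $\mathcal C$ if and only if it satisfies every sentence of $\Pi$. Let $\mathcal{P}r$ be the class of projective left $S$-posets (the projective objects of this category, i.e. those with the lifting property with respect to all epimorphisms), and let $\mathcal{SF}$ be the class of strongly flat left $S$-posets, i.e. of those $B$ that satisfy both * (P): for all $b,b'\in B$ and $s,s'\in S$, if $sb\le s'b'$, then there are $b''\in B$ and $u,u'\in S$ with $b=ub''$, $b'=u'b''$ and $su\le s'u'$; * (E): for all $b\in B$ and $s,s'\in S$, if $sb\le s'b$, then there are $b''\in B$ and $u\in S$ with $b=ub''$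 and $su\le s'u$. Then the following are equivalent: 1. the class $\mathcal{P}r$ is axiomatisable; 2. for every set $I$ and every ultrafilter $D$ on $I$, the ultrapower $S^I/D$, regarded as a left $S$-poset with $s[(a_i)]=[(sa_i)]$ and with $[(a_i)]\le[(b_i)]$ if and only if $\{i: a_i\le b_i\}\in D$, is projective; 3. the class $\mathcal{SF}$ is axiomatisable and $\mathcal{SF}=\mathcal{P}r$. -/

import Mathlib

open CategoryTheory FirstOrder

universe u

/-- A left `S`-poset over a pomonoid `S`: a nonempty partially ordered set with a left action of
the monoid `S` that is monotone in both coordinates. -/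
structure SPos (S : Type u) [Monoid S] [PartialOrder S] : Type (u + 1) where
  carrier : Type u
  [partialOrder : PartialOrder carrier]
  [mulAction : MulAction S carrier]
  [nonempty : Nonempty carrier]
  smul_mono_right : ∀ (s : S) {a b : carrier}, a ≤ b → s • a ≤ s • b
  smul_mono_left : ∀ {s t : S} (a : carrier), s ≤ t → s • a ≤ t • a

attribute [instance] SPos.partialOrder SPos.mulAction SPos.nonempty

namespace SPos

/-- `S`-pomorphisms: maps preserving the action and the order. -/
@[ext]
structure Hom {S : Type u} [Monoid S] [PartialOrder S] (A B : SPos S) : Type u where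
  toFun : A.carrier → B.carrier
  map_smul : ∀ (s : S) (a : A.carrier), toFun (s • a) = s • toFun a
  monotone : Monotone toFun

/-- The category of left `S`-posets and `S`-pomorphisms. -/
instance instCategory (S : Type u) [Monoid S] [PartialOrder S] : Category.{u} (SPos S) where
  Hom A B := Hom A B
  id A := ⟨fun a => a, fun _ _ => rfl, fun _ _ h => h⟩
  comp f g := ⟨fun a => g.toFun (f.toFun a),
    fun s a => by rw [f.map_smul, g.map_smul],
    fun _ _ h => g.monotone (f.monotone h)⟩

/-- The ultrapower `S^I / D` of `S` as a left `S`-poset: germs along `D` of functions `I → S`,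
with `s[f] = [i ↦ s * f i]`, and `[f] ≤ [g]` iff `f i ≤ g i` for `D`-almost all `i`. -/
def ultrapower (S : Type u) [Monoid S] [PartialOrder S] [MulLeftMono S] [MulRightMono S]
    (I : Type u) (D : Ultrafilter I) : SPos S where
  carrier := Filter.Germ (D : Filter I) S
  nonempty := ⟨((1 : S) : Filter.Germ (D : Filter I) S)⟩
  smul_mono_right := by
    intro s a b
    refine Filter.Germ.inductionOn₂ a b fun f g h => ?_
    have h' : ∀ᶠ i in (D : Filter I), f i ≤ g i := h
    exact h'.mono fun i hi => mul_le_mul_right hi s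
  smul_mono_left := by
    intro s t a h
    refine Filter.Germ.inductionOn a fun f => ?_
    exact Filter.Eventually.of_forall fun i => mul_le_mul_left h (f i)

/-- Condition (P). -/
def CondP {S : Type u} [Monoid S] [PartialOrder S] (B : SPos S) : Prop :=
  ∀ (b b' : B.carrier) (s s' : S), s • b ≤ s' • b' →
    ∃ (b'' : B.carrier) (u u' : S), b = u • b'' ∧ b' = u' • b'' ∧ s * u ≤ s' * u'

/-- Condition (E). -/
def CondE {S : Type u} [Monoid S] [PartialOrder S] (B : SPos S) : Prop :=
  ∀ (b : B.carrier) (s s' : S), s • b ≤ s' • b →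
    ∃ (b'' : B.carrier) (u : S), b = u • b'' ∧ s * u ≤ s' * u

/-- The class of strongly flat left `S`-posets. -/
def SF (S : Type u) [Monoid S] [PartialOrder S] : Set (SPos S) :=
  {B | CondP B ∧ CondE B}

/-- The class of projective left `S`-posets: the projective objects of the category
of left `S`-posets. -/
def Pr (S : Type u) [Monoid S] [PartialOrder S] : Set (SPos S) :=
  {P | Projective P}

/-- Function symbols: one unary symbol for each `s : S`. -/
inductive LangFun (S : Type u) : ℕ → Type u
  | act (s : S) : LangFun S 1

/-- Relation symbols (besides equality): one binary symbol. -/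
inductive LangRel : ℕ → Type
  | le : LangRel 2

/-- The first-order language of left `S`-posets. -/
def lang (S : Type u) : FirstOrder.Language.{u, 0} :=
  ⟨LangFun S, LangRel⟩

/-- A left `S`-poset as a first-order structure. -/
instance instStructure {S : Type u} [Monoid S] [PartialOrder S] (A : SPos S) :
    (lang S).Structure A.carrier where
  funMap f x := match f with
    | LangFun.act s => s • x 0
  RelMap r x := match r with
    | LangRel.le => x 0 ≤ x 1

/-- A class of left `S`-posets is axiomatisable if it consists of exactly those left `S`-posets
that satisfy every sentence of some set of first-order sentences. -/
def Axiomatisable {S : Type u} [Monoid S] [PartialOrder S] (C : Set (SPos S)) : Prop :=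
  ∃ T : (lang S).Theory, ∀ A : SPos S, A ∈ C ↔ A.carrier ⊨ T

end SPos

/-! Splitting the projection from the free `S`-poset on the elements of `B` shows that `B` is
projective iff it has coordinates (`IsCoord`); epimorphisms being surjective is what makes
coordinates suffice. Hence projectives are strongly flat, and 1 → 2 is Łoś's theorem applied to `S`.

For 2 → 3, (P) and (E) in ultrapowers over finite sets yield finite generating sets in `S`, so (P)
and (E) become first-order with finite disjunctions. For `SF ⊆ Pr`, (P) splits a strongly flat `B`
into locally cyclic components. Finite pieces of a component lift to `S` by (E), so the component
maps into an ultrapower of `S`, whose coordinates give it coefficients in `S`. Only a generator is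
missing, and one is found in `CondE.exists_coord` because suitable families in `S` are almost
constant (`eventually_const_of_smul_eq`). -/

namespace SPos

variable {S : Type u} [Monoid S] [PartialOrder S]

/-! ### Epimorphisms of `S`-posets are surjective -/

/-- Two copies of an `S`-poset `B`, indexed by `Bool`. -/
structure TwoCopies (B : SPos S) (C : Set B.carrier) : Type u where
  point : B.carrier
  side : Bool

/-- The preorder on two copies of `B` in which points of distinct copies are comparable exactly
through a point of `C`. Its antisymmetrization is the amalgam of two copies of `B` over `C`. -/
instance TwoCopies.instPreorder (B : SPos S) (C : Set B.carrier) : Preorder (TwoCopies B C) where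
  le p q := p.point ≤ q.point ∧ (p.side = q.side ∨ ∃ c ∈ C, p.point ≤ c ∧ c ≤ q.point)
  le_refl p := ⟨le_rfl, Or.inl rfl⟩
  le_trans := by
    rintro p q r ⟨h, h'⟩ ⟨k, k'⟩
    refine ⟨h.trans k, ?_⟩
    rcases h' with h' | ⟨c, hc, h1, h2⟩
    · rcases k' with k' | ⟨c, hc, h1, h2⟩
      · exact Or.inl (h'.trans k')
      · exact Or.inr ⟨c, hc, h.trans h1, h2⟩
    · exact Or.inr ⟨c, hc, h1, h2.trans k⟩

theorem TwoCopies.smul_mono {B : SPos S} {C : Set B.carrier} (hC : ∀ (s : S), ∀ c ∈ C, s • c ∈ C)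
    (s : S) {p q : TwoCopies B C} (h : p ≤ q) :
    (⟨s • p.point, p.side⟩ : TwoCopies B C) ≤ ⟨s • q.point, q.side⟩ := by
  refine ⟨B.smul_mono_right s h.1, h.2.imp id ?_⟩
  rintro ⟨c, hc, h1, h2⟩
  exact ⟨s • c, hC s c hc, B.smul_mono_right s h1, B.smul_mono_right s h2⟩

/-- The amalgam of two copies of `B` over a subset `C` that is closed under the action. -/
def amalgam (B : SPos S) (C : Set B.carrier) (hC : ∀ (s : S), ∀ c ∈ C, s • c ∈ C) : SPos S where
  carrier := Antisymmetrization (TwoCopies B C) (· ≤ ·)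
  nonempty := ⟨toAntisymmetrization (· ≤ ·) ⟨Classical.arbitrary B.carrier, true⟩⟩
  mulAction :=
    { smul := fun s => Quotient.map' (fun p => ⟨s • p.point, p.side⟩)
        fun _ _ h => ⟨TwoCopies.smul_mono hC s h.1, TwoCopies.smul_mono hC s h.2⟩
      one_smul := fun a => Quotient.inductionOn' a fun p =>
        congrArg (fun b => toAntisymmetrization (α := TwoCopies B C) (· ≤ ·) ⟨b, p.side⟩)
          (one_smul S p.point)
      mul_smul := fun s t a => Quotient.inductionOn' a fun p =>
        congrArg (fun b => toAntisymmetrization (α := TwoCopies B C) (· ≤ ·) ⟨b, p.side⟩)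
          (mul_smul s t p.point) }
  smul_mono_right := fun s a b => Quotient.inductionOn₂' a b fun _ _ h =>
    TwoCopies.smul_mono hC s h
  smul_mono_left := fun {s t} a h => Quotient.inductionOn' a fun p =>
    show (⟨s • p.point, p.side⟩ : TwoCopies B C) ≤ ⟨t • p.point, p.side⟩ from
      ⟨B.smul_mono_left p.point h, Or.inl rfl⟩

/-- The inclusion of a copy of `B` into the amalgam. -/
def amalgamInclusion (B : SPos S) (C : Set B.carrier) (hC : ∀ (s : S), ∀ c ∈ C, s • c ∈ C)
    (i : Bool) : B ⟶ amalgam B C hC where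
  toFun := fun b => toAntisymmetrization (α := TwoCopies B C) (· ≤ ·) ⟨b, i⟩
  map_smul := fun _ _ => rfl
  monotone := fun b b' h =>
    show (⟨b, i⟩ : TwoCopies B C) ≤ ⟨b', i⟩ from ⟨h, Or.inl rfl⟩

theorem amalgamInclusion_eq_iff (B : SPos S) (C : Set B.carrier)
    (hC : ∀ (s : S), ∀ c ∈ C, s • c ∈ C) (b : B.carrier) :
    Hom.toFun (amalgamInclusion B C hC true) b = Hom.toFun (amalgamInclusion B C hC false) b ↔
      b ∈ C := by
  refine Iff.trans (Quotient.eq'' (s₁ := AntisymmRel.setoid (TwoCopies B C) (· ≤ ·))) ?_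
  constructor
  · rintro ⟨⟨_, h⟩, -⟩
    rcases h with h | ⟨c, hc, h1, h2⟩
    · exact absurd h Bool.noConfusion
    · rwa [show b = c from le_antisymm h1 h2]
  · intro hb
    exact ⟨⟨le_rfl, Or.inr ⟨b, hb, le_rfl, le_rfl⟩⟩, ⟨le_rfl, Or.inr ⟨b, hb, le_rfl, le_rfl⟩⟩⟩

/-- The two inclusions of `B` into the amalgam over the image of `f` agree after `f`, hence
everywhere, yet they agree only on that image. -/
theorem surjective_of_epi {A B : SPos S} (f : A ⟶ B) [Epi f] :
    Function.Surjective (Hom.toFun f) := by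
  have hC : ∀ (s : S), ∀ c ∈ Set.range (Hom.toFun f), s • c ∈ Set.range (Hom.toFun f) := by
    rintro s _ ⟨a, rfl⟩
    exact ⟨s • a, Hom.map_smul f s a⟩
  have h : amalgamInclusion B _ hC true = amalgamInclusion B _ hC false := by
    rw [← cancel_epi f]
    refine Hom.ext (funext fun a => ?_)
    exact (amalgamInclusion_eq_iff B _ hC _).2 ⟨a, rfl⟩
  intro b
  exact (amalgamInclusion_eq_iff B _ hC b).1 (congrArg (fun g => Hom.toFun g b) h)

theorem epi_of_surjective {A B : SPos S} (f : A ⟶ B) (hf : Function.Surjective (Hom.toFun f)) :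
    Epi f where
  left_cancellation g h hgh := by
    refine Hom.ext (funext fun b => ?_)
    obtain ⟨a, rfl⟩ := hf b
    exact congrArg (fun k => Hom.toFun k a) hgh

/-! ### Coordinate systems and projectivity -/

/-- Elements of the free left `S`-poset on a type `X`. -/
@[ext]
structure FreeCarrier (S X : Type u) : Type u where
  coeff : S
  gen : X

/-- The free left `S`-poset on a nonempty type: a disjoint union of copies of `S`. -/
def free (S : Type u) [Monoid S] [PartialOrder S] [MulLeftMono S] [MulRightMono S]
    (X : Type u) [Nonempty X] : SPos S where
  carrier := FreeCarrier S X
  partialOrder :=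
    { le := fun p q => p.coeff ≤ q.coeff ∧ p.gen = q.gen
      le_refl := fun _ => ⟨le_rfl, rfl⟩
      le_trans := fun _ _ _ h k => ⟨h.1.trans k.1, h.2.trans k.2⟩
      le_antisymm := fun _ _ h k => FreeCarrier.ext (le_antisymm h.1 k.1) h.2 }
  mulAction :=
    { smul := fun s p => ⟨s * p.coeff, p.gen⟩
      one_smul := fun p => FreeCarrier.ext (one_mul p.coeff) rfl
      mul_smul := fun s t p => FreeCarrier.ext (mul_assoc s t p.coeff) rfl }
  nonempty := ⟨⟨1, Classical.arbitrary X⟩⟩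
  smul_mono_right := fun s _ _ h => ⟨mul_le_mul_right h.1 s, h.2⟩
  smul_mono_left := fun a h => ⟨mul_le_mul_left h a.coeff, rfl⟩

/-- The canonical projection from the free `S`-poset on the elements of `B` to `B`. -/
def freeProj [MulLeftMono S] [MulRightMono S] (B : SPos S) : free S B.carrier ⟶ B where
  toFun := fun p => p.coeff • p.gen
  map_smul := fun s p => mul_smul s p.coeff p.gen
  monotone := by
    rintro ⟨s, b⟩ ⟨t, b'⟩ ⟨h, rfl : b = b'⟩
    exact B.smul_mono_left b h

/-- A coordinate system on `B`: a section of the projection from the free `S`-poset on the elements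
of `B`, given by a coefficient and a generator for each element of `B`. -/
structure IsCoord (B : SPos S) (coeff : B.carrier → S) (gen : B.carrier → B.carrier) : Prop where
  smul_gen : ∀ b, coeff b • gen b = b
  coeff_smul : ∀ (s : S) b, coeff (s • b) = s * coeff b
  gen_smul : ∀ (s : S) b, gen (s • b) = gen b
  coeff_mono : ∀ b b', b ≤ b' → coeff b ≤ coeff b'
  gen_eq : ∀ b b', b ≤ b' → gen b = gen b'

/-- Preimages need to be chosen only for images of generators. Comparable elements share a
generator, so the arbitrary choice does not spoil monotonicity. -/
theorem IsCoord.mem_Pr {B : SPos S} {coeff : B.carrier → S} {gen : B.carrier → B.carrier}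
    (h : IsCoord B coeff gen) : B ∈ Pr S := by
  refine ⟨fun {E X} f e _ => ?_⟩
  choose l hl using surjective_of_epi e
  refine ⟨⟨fun b => coeff b • l (Hom.toFun f (gen b)), fun s b => ?_, fun b b' hb => ?_⟩, ?_⟩
  · rw [h.coeff_smul, h.gen_smul, mul_smul]
  · change coeff b • l (Hom.toFun f (gen b)) ≤ coeff b' • l (Hom.toFun f (gen b'))
    rw [h.gen_eq b b' hb]
    exact E.smul_mono_left _ (h.coeff_mono b b' hb)
  · refine Hom.ext (funext fun b => ?_)
    change Hom.toFun e (coeff b • l (Hom.toFun f (gen b))) = Hom.toFun f b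
    rw [Hom.map_smul, hl, ← Hom.map_smul, h.smul_gen]

theorem exists_isCoord [MulLeftMono S] [MulRightMono S] {B : SPos S} (hB : B ∈ Pr S) :
    ∃ coeff gen, IsCoord B coeff gen := by
  have : Epi (freeProj B) :=
    epi_of_surjective _ fun b => ⟨⟨1, b⟩, one_smul S b⟩
  have : Projective B := hB
  let σ : B ⟶ free S B.carrier := Projective.factorThru (𝟙 B) (freeProj B)
  have hσ : σ ≫ freeProj B = 𝟙 B := Projective.factorThru_comp _ _
  exact ⟨fun b => (Hom.toFun σ b).coeff, fun b => (Hom.toFun σ b).gen,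
    fun b => congrArg (fun k => Hom.toFun k b) hσ,
    fun s b => congrArg FreeCarrier.coeff (Hom.map_smul σ s b),
    fun s b => (congrArg FreeCarrier.gen (Hom.map_smul σ s b) :),
    fun b b' h => (Hom.monotone σ h).1,
    fun b b' h => (Hom.monotone σ h).2⟩

theorem IsCoord.mem_SF {B : SPos S} {coeff : B.carrier → S} {gen : B.carrier → B.carrier}
    (h : IsCoord B coeff gen) : B ∈ SF S := by
  refine ⟨fun b b' s s' hb => ?_, fun b s s' hb => ?_⟩
  · have hg := h.gen_eq _ _ hb
    have hc := h.coeff_mono _ _ hb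
    rw [h.gen_smul, h.gen_smul] at hg
    rw [h.coeff_smul, h.coeff_smul] at hc
    refine ⟨gen b, coeff b, coeff b', (h.smul_gen b).symm, ?_, hc⟩
    rw [hg, h.smul_gen]
  · have hc := h.coeff_mono _ _ hb
    rw [h.coeff_smul, h.coeff_smul] at hc
    exact ⟨gen b, coeff b, (h.smul_gen b).symm, hc⟩

theorem Pr_subset_SF [MulLeftMono S] [MulRightMono S] : Pr S ⊆ SF S := by
  intro B hB
  obtain ⟨_, _, h⟩ := exists_isCoord hB
  exact h.mem_SF

/-- The monoid `S` as a left `S`-poset. -/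
def regular (S : Type u) [Monoid S] [PartialOrder S] [MulLeftMono S] [MulRightMono S] :
    SPos S where
  carrier := S
  smul_mono_right := fun s _ _ h => mul_le_mul_right h s
  smul_mono_left := fun a h => mul_le_mul_left h a

theorem regular_mem_Pr [MulLeftMono S] [MulRightMono S] : regular S ∈ Pr S :=
  IsCoord.mem_Pr (coeff := fun s => s) (gen := fun _ => (1 : S))
    ⟨fun s => mul_one (M := S) s, fun _ _ => rfl, fun _ _ => rfl, fun _ _ h => h, fun _ _ _ => rfl⟩

/-! ### Ultrapowers -/

section Ultrapower

variable [MulLeftMono S] [MulRightMono S] {I : Type u} {D : Ultrafilter I}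

/-- The element of the ultrapower represented by a function. -/
def germ (D : Ultrafilter I) (f : I → S) : (ultrapower S I D).carrier :=
  (f : Filter.Germ (D : Filter I) S)

theorem exists_germ (y : (ultrapower S I D).carrier) : ∃ f, germ D f = y :=
  Quotient.exists_rep y

theorem germ_eq {f g : I → S} : germ D f = germ D g ↔ ∀ᶠ i in (D : Filter I), f i = g i :=
  Filter.Germ.coe_eq

theorem smul_germ_eq {s : S} {f g : I → S} :
    s • germ D f = germ D g ↔ ∀ᶠ i in (D : Filter I), s * f i = g i :=
  germ_eq

theorem smul_germ (s : S) (f : I → S) : s • germ D f = germ D fun i => s * f i :=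
  rfl

open FirstOrder.Language in
/-- The ultrapower of `S` is its model-theoretic ultrapower. -/
def ultrapowerEquivProduct (D : Ultrafilter I) :
    (lang S).Equiv ((D : Filter I).Product fun _ => (regular S).carrier)
      (ultrapower S I D).carrier where
  -- Both carriers are the same quotient of `I → S`; only the structures need comparing.
  toFun := id
  invFun := id
  left_inv _ := rfl
  right_inv _ := rfl
  map_fun' := by
    rintro n ⟨s⟩ x
    obtain ⟨y, rfl⟩ : ∃ y : Fin 1 → I → S, 
        (fun i => ((germ D (y i) : (ultrapower S I D).carrier) :
          (D : Filter I).Product fun _ => (regular S).carrier)) = x :=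
      ⟨fun i => (x i).out, funext fun i => Quotient.out_eq' (x i)⟩
    exact Ultraproduct.funMap_cast (L := lang S) (M := fun _ => (regular S).carrier) (u := D)
      (LangFun.act s : (lang S).Functions 1) y
  map_rel' := by
    rintro n ⟨⟩ x
    obtain ⟨y, rfl⟩ : ∃ y : Fin 2 → I → S, 
        (fun i => ((germ D (y i) : (ultrapower S I D).carrier) :
          (D : Filter I).Product fun _ => (regular S).carrier)) = x :=
      ⟨fun i => (x i).out, funext fun i => Quotient.out_eq' (x i)⟩
    exact (relMap_quotient_mk' (L := lang S)
      ((D : Filter I).productSetoid fun _ => (regular S).carrier)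
      (ps := Ultraproduct.setoidPrestructure (fun _ => (regular S).carrier) D)
      (LangRel.le : (lang S).Relations 2) y).symm

theorem ultrapower_mem_of_axiomatisable {C : Set (SPos S)} (hC : Axiomatisable C)
    (hS : regular S ∈ C) : ultrapower S I D ∈ C := by
  obtain ⟨T, hT⟩ := hC
  have hST : (regular S).carrier ⊨ T := (hT _).1 hS
  refine (hT _).2 ⟨fun φ hφ => ?_⟩
  refine (Language.StrongHomClass.realize_sentence (ultrapowerEquivProduct D) φ).1 ?_
  exact (Language.Ultraproduct.sentence_realize φ).2
    (Filter.Eventually.of_forall fun _ => hST.realize_of_mem φ hφ)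

end Ultrapower

end SPos

namespace SPos

variable {S : Type u} [Monoid S] [PartialOrder S]

/-! ### Axiomatisability of strong flatness -/

section Axioms

open FirstOrder.Language

/-- The sentence saying that `s b ≤ t b'` implies that `b` and `b'` are the multiples by `p.1` and
`p.2` of a common element, for some `p ∈ F`. -/
noncomputable def sentenceP (s t : S) (F : Finset (S × S)) : (lang S).Sentence :=
  ∀' ∀' ((Relations.boundedFormula₂ (LangRel.le : (lang S).Relations 2)
      (Functions.apply₁ (LangFun.act s : (lang S).Functions 1) (&0))
      (Functions.apply₁ (LangFun.act t : (lang S).Functions 1) (&1))).imp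
    (BoundedFormula.iSup fun p : F => ∃'
      ((&0 =' Functions.apply₁ (LangFun.act p.1.1 : (lang S).Functions 1) (&2)) ⊓
       (&1 =' Functions.apply₁ (LangFun.act p.1.2 : (lang S).Functions 1) (&2)))))

/-- The sentence saying that `s b ≤ t b` implies that `b` is a multiple by some `u ∈ F`. -/
noncomputable def sentenceE (s t : S) (F : Finset S) : (lang S).Sentence :=
  ∀' ((Relations.boundedFormula₂ (LangRel.le : (lang S).Relations 2)
      (Functions.apply₁ (LangFun.act s : (lang S).Functions 1) (&0))
      (Functions.apply₁ (LangFun.act t : (lang S).Functions 1) (&0))).imp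
    (BoundedFormula.iSup fun p : F => ∃'
      (&0 =' Functions.apply₁ (LangFun.act p.1 : (lang S).Functions 1) (&1))))

theorem realize_sentenceP (B : SPos S) (s t : S) (F : Finset (S × S)) :
    B.carrier ⊨ sentenceP s t F ↔ ∀ b b' : B.carrier, s • b ≤ t • b' →
      ∃ p ∈ F, ∃ c : B.carrier, b = p.1 • c ∧ b' = p.2 • c := by
  simp only [sentenceP, Sentence.Realize, Formula.Realize, BoundedFormula.realize_all,
    BoundedFormula.realize_imp, BoundedFormula.realize_iSup,
    BoundedFormula.realize_ex, BoundedFormula.realize_inf, BoundedFormula.realize_bdEqual,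
    Subtype.exists, exists_prop]
  rfl

theorem realize_sentenceE (B : SPos S) (s t : S) (F : Finset S) :
    B.carrier ⊨ sentenceE s t F ↔ ∀ b : B.carrier, s • b ≤ t • b →
      ∃ p ∈ F, ∃ c : B.carrier, b = p • c := by
  simp only [sentenceE, Sentence.Realize, Formula.Realize, BoundedFormula.realize_all,
    BoundedFormula.realize_imp, BoundedFormula.realize_iSup,
    BoundedFormula.realize_ex, BoundedFormula.realize_bdEqual,
    Subtype.exists, exists_prop]
  rfl

end Axioms

/-- Finite generation of the right `S`-acts `{(x, y) | s x ≤ t y}`. -/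
def FinGenPairs (S : Type u) [Monoid S] [PartialOrder S] : Prop :=
  ∀ s t : S, ∃ F : Finset (S × S), (∀ p ∈ F, s * p.1 ≤ t * p.2) ∧
    ∀ x y : S, s * x ≤ t * y → ∃ p ∈ F, ∃ z, x = p.1 * z ∧ y = p.2 * z

/-- Finite generation of the right ideals `{x | s x ≤ t x}`. -/
def FinGenIdeals (S : Type u) [Monoid S] [PartialOrder S] : Prop :=
  ∀ s t : S, ∃ F : Finset S, (∀ p ∈ F, s * p ≤ t * p) ∧
    ∀ x : S, s * x ≤ t * x → ∃ p ∈ F, ∃ z, x = p * z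

/-- Any witness from (P) or (E) factors through one of finitely many generators, so the quantifier
over `S` becomes a finite disjunction. The inequality in `S` holds for the generators themselves and
needs no axiom. -/
theorem axiomatisable_SF_of_finGen (hP : FinGenPairs S) (hE : FinGenIdeals S) :
    Axiomatisable (SF S) := by
  choose F hF hF' using hP
  choose G hG hG' using hE
  refine ⟨Set.range (fun p : S × S => sentenceP p.1 p.2 (F p.1 p.2)) ∪
    Set.range (fun p : S × S => sentenceE p.1 p.2 (G p.1 p.2)), fun B => ?_⟩
  rw [Language.Theory.model_iff]
  simp only [Set.mem_union, Set.mem_range, Prod.exists, or_imp, forall_and, forall_exists_index]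
  constructor
  · rintro ⟨h1, h2⟩
    constructor
    · rintro φ s t rfl
      refine (realize_sentenceP B s t _).2 fun b b' h => ?_
      obtain ⟨c, x, y, rfl, rfl, hxy⟩ := h1 b b' s t h
      obtain ⟨p, hp, z, rfl, rfl⟩ := hF' s t x y hxy
      exact ⟨p, hp, z • c, mul_smul _ _ _, mul_smul _ _ _⟩
    · rintro φ s t rfl
      refine (realize_sentenceE B s t _).2 fun b h => ?_
      obtain ⟨c, x, rfl, hx⟩ := h2 b s t h
      obtain ⟨p, hp, z, rfl⟩ := hG' s t x hx
      exact ⟨p, hp, z • c, mul_smul _ _ _⟩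
  · rintro ⟨h1, h2⟩
    refine ⟨fun b b' s t h => ?_, fun b s t h => ?_⟩
    · obtain ⟨p, hp, c, hb, hb'⟩ := (realize_sentenceP B s t _).1 (h1 _ s t rfl) b b' h
      exact ⟨c, p.1, p.2, hb, hb', hF s t p hp⟩
    · obtain ⟨p, hp, c, hb⟩ := (realize_sentenceE B s t _).1 (h2 _ s t rfl) b h
      exact ⟨c, p, hb, hG s t p hp⟩

variable [MulLeftMono S] [MulRightMono S]

/-- Otherwise each finite `F` misses some solution `w F`. Along an ultrafilter containing all cones
`{F | F₀ ⊆ F}`, (P) factors the germ of `w` through a single solution `(u, u')`, which lies in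
almost every `F`. -/
theorem finGenPairs_of_ultrapower
    (h : ∀ (I : Type u) (D : Ultrafilter I), CondP (ultrapower S I D)) : FinGenPairs S := by
  classical
  intro s t
  by_contra! hcon
  have key : ∀ F : Finset (S × S), ∃ xy : S × S, s * xy.1 ≤ t * xy.2 ∧
      ∀ p ∈ F, s * p.1 ≤ t * p.2 → ∀ z, xy.1 = p.1 * z → xy.2 ≠ p.2 * z := by
    intro F
    obtain ⟨x, y, hxy, h⟩ := hcon (F.filter fun p => s * p.1 ≤ t * p.2)
      fun p hp => (Finset.mem_filter.1 hp).2
    exact ⟨(x, y), hxy, fun p hp hp' => h p (Finset.mem_filter.2 ⟨hp, hp'⟩)⟩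
  choose w hw hw' using key
  let D : Ultrafilter (Finset (S × S)) := Ultrafilter.of Filter.atTop
  have hle : s • germ D (fun F => (w F).1) ≤ t • germ D (fun F => (w F).2) :=
    Filter.Eventually.of_forall hw
  obtain ⟨y, u, u', h1, h2, h3⟩ := h _ D _ _ _ _ hle
  obtain ⟨c, rfl⟩ := exists_germ y
  rw [smul_germ, germ_eq] at h1 h2
  have hD : ∀ᶠ F in (D : Filter (Finset (S × S))), {(u, u')} ≤ F :=
    Ultrafilter.of_le Filter.atTop (Filter.eventually_ge_atTop _)
  obtain ⟨F, hF1, hF2, hF3⟩ := (h1.and (h2.and hD)).exists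
  exact hw' F (u, u') (hF3 (Finset.mem_singleton_self _)) h3 _ hF1 hF2

theorem finGenIdeals_of_ultrapower
    (h : ∀ (I : Type u) (D : Ultrafilter I), CondE (ultrapower S I D)) : FinGenIdeals S := by
  classical
  intro s t
  by_contra! hcon
  have key : ∀ F : Finset S, ∃ x : S, s * x ≤ t * x ∧
      ∀ p ∈ F, s * p ≤ t * p → ∀ z, x ≠ p * z := by
    intro F
    obtain ⟨x, hx, h⟩ := hcon (F.filter fun p => s * p ≤ t * p)
      fun p hp => (Finset.mem_filter.1 hp).2
    exact ⟨x, hx, fun p hp hp' => h p (Finset.mem_filter.2 ⟨hp, hp'⟩)⟩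
  choose w hw hw' using key
  let D : Ultrafilter (Finset S) := Ultrafilter.of Filter.atTop
  have hle : s • germ D w ≤ t • germ D w := Filter.Eventually.of_forall hw
  obtain ⟨y, u, h1, h2⟩ := h _ D _ _ _ hle
  obtain ⟨c, rfl⟩ := exists_germ y
  rw [smul_germ, germ_eq] at h1
  have hD : ∀ᶠ F in (D : Filter (Finset S)), {u} ≤ F :=
    Ultrafilter.of_le Filter.atTop (Filter.eventually_ge_atTop _)
  obtain ⟨F, hF1, hF2⟩ := (h1.and hD).exists
  exact hw' F u (hF2 (Finset.mem_singleton_self _)) h2 _ hF1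

end SPos

namespace SPos

variable {S : Type u} [Monoid S] [PartialOrder S]

/-! ### Strongly flat `S`-posets when all ultrapowers of `S` are projective -/

section

variable [MulLeftMono S] [MulRightMono S]

/-- The germ `x` of `n ↦ δ ^ n` is fixed by every `δ ^ k * v ^ k`, hence so is its coefficient `ψ x`
under left multiplication. Some actual power `δ ^ n` is a right multiple of `ψ x`, so it is fixed
too, for all `k` at once. -/
theorem mul_eq_one_symm_of_ultrapower
    (h : ∀ (I : Type u) (D : Ultrafilter I), ultrapower S I D ∈ Pr S) {v δ : S}
    (hv : v * δ = 1) : δ * v = 1 := by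
  let D : Ultrafilter (ULift.{u} ℕ) := Filter.hyperfilter _
  obtain ⟨ψ, g, hψ⟩ := exists_isCoord (h _ D)
  let x := germ D fun n => δ ^ n.down
  have hvδ : ∀ n, v ^ n * δ ^ n = 1 := fun n => by
    induction n with
    | zero => simp
    | succ n ih => rw [pow_succ v, pow_succ' δ, mul_assoc, ← mul_assoc v, hv, one_mul, ih]
  have hx : ∀ k, (δ ^ k * v ^ k) • x = x := by
    intro k
    refine smul_germ_eq.2 ?_
    have hk : ∀ᶠ n : ULift.{u} ℕ in (D : Filter _), n ∉ {n : ULift.{u} ℕ | n.down < k} := by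
      refine Filter.hyperfilter_le_cofinite (Set.Finite.compl_mem_cofinite ?_)
      exact (Set.finite_lt_nat k).preimage ULift.down_injective.injOn
    filter_upwards [hk] with n hn
    obtain ⟨m, hm⟩ := Nat.exists_eq_add_of_le (not_lt.1 hn)
    rw [hm, pow_add, mul_assoc, ← mul_assoc (v ^ k), hvδ, one_mul]
  have hz : ∀ k, δ ^ k * v ^ k * ψ x = ψ x := fun k => by
    rw [← hψ.coeff_smul, hx]
  obtain ⟨c, hc⟩ := exists_germ (g x)
  have hcx : ψ x • germ D c = x := by rw [hc, hψ.smul_gen]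
  obtain ⟨⟨n⟩, hn⟩ := (smul_germ_eq.1 hcx).exists
  have hn : ψ x * c ⟨n⟩ = δ ^ n := hn
  -- Here `k = n + 1`, one more than the exponent, leaves one uncancelled `v`.
  have h1 : δ ^ n = δ ^ (n + 1) * v := by
    calc δ ^ n = δ ^ (n + 1) * v ^ (n + 1) * ψ x * c ⟨n⟩ := by rw [hz, hn]
      _ = δ ^ (n + 1) * v * (v ^ n * δ ^ n) := by
        rw [mul_assoc _ (ψ x), hn, pow_succ' v]; simp only [mul_assoc]
      _ = δ ^ (n + 1) * v := by rw [hvδ, mul_one]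
  calc δ * v = v ^ n * δ ^ n * δ * v := by rw [hvδ, one_mul]
    _ = v ^ n * (δ ^ (n + 1) * v) := by rw [pow_succ]; simp only [mul_assoc]
    _ = 1 := by rw [← h1, hvδ]

/-- In an ultrapower of `S`, an element some multiple of which is the same multiple of `1` is
constant. -/
theorem eventually_const_of_smul_eq
    (h : ∀ (I : Type u) (D : Ultrafilter I), ultrapower S I D ∈ Pr S) {I : Type u}
    {D : Ultrafilter I} (f : I → S) (s : S) (hf : ∀ᶠ i in (D : Filter I), s * f i = s) :
    ∃ v, ∀ᶠ i in (D : Filter I), f i = v := by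
  obtain ⟨ψ, g, hψ⟩ := exists_isCoord (h _ D)
  let o := germ D fun _ => (1 : S)
  have hs : s • germ D f = s • o := smul_germ_eq.2 <| hf.mono fun i hi => hi.trans (mul_one s).symm
  -- The common multiple forces a common generator `[q]`. Almost every `q j` is a right inverse of
  -- `ψ o`, hence its unique inverse, so `q` is almost constant, and so is `f`.
  have hg : g (germ D f) = g o := by rw [← hψ.gen_smul s, hs, hψ.gen_smul]
  obtain ⟨q, hq⟩ := exists_germ (g o)
  have ho : ψ o • germ D q = o := by rw [hq, hψ.smul_gen]
  have hf' : ψ (germ D f) • germ D q = germ D f := by rw [hq, ← hg, hψ.smul_gen]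
  have ho := smul_germ_eq.1 ho
  have hf' := smul_germ_eq.1 hf'
  obtain ⟨i, hi⟩ := ho.exists
  refine ⟨ψ (germ D f) * q i, ?_⟩
  filter_upwards [ho, hf'] with j hj hj'
  rw [← hj']
  congr 1
  calc q j = q i * ψ o * q j := by rw [mul_eq_one_symm_of_ultrapower h hi, one_mul]
    _ = q i := by rw [mul_assoc, hj, mul_one]

end

theorem exists_common_generator {B : SPos S} {K : Set B.carrier} (hne : K.Nonempty)
    (hK : ∀ (s : S) b, s • b ∈ K ↔ b ∈ K)
    (hdir : ∀ b ∈ K, ∀ b' ∈ K, ∃ (c : B.carrier) (s t : S), b = s • c ∧ b' = t • c)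
    (F : Finset B.carrier) : ∃ c ∈ K, ∀ b ∈ F, b ∈ K → ∃ s : S, s • c = b := by
  classical
  induction F using Finset.induction_on with
  | empty =>
    obtain ⟨c, hc⟩ := hne
    exact ⟨c, hc, by simp⟩
  | insert b F _ ih =>
    obtain ⟨c, hc, ih⟩ := ih
    by_cases hb : b ∈ K
    · obtain ⟨c', s, t, h1, h2⟩ := hdir c hc b hb
      refine ⟨c', (hK s c').1 (h1 ▸ hc), fun x hx hxK => ?_⟩
      rcases Finset.mem_insert.1 hx with rfl | hx
      · exact ⟨t, h2.symm⟩
      · obtain ⟨r, rfl⟩ := ih x hx hxK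
        exact ⟨r * s, by rw [h1, mul_smul]⟩
    · refine ⟨c, hc, fun x hx hxK => ?_⟩
      rcases Finset.mem_insert.1 hx with rfl | hx
      · exact absurd hxK hb
      · exact ih x hx hxK

/-- (E) is applied to one inequality at a time; those already lifted survive further right
multiplication. -/
theorem CondE.exists_forall_mul_le [MulRightMono S] {B : SPos S} (hE : CondE B) (c : B.carrier)
    (Q : Finset (S × S)) :
    ∃ (c' : B.carrier) (w : S), c = w • c' ∧
      ∀ p ∈ Q, p.1 • c ≤ p.2 • c → p.1 * w ≤ p.2 * w := by
  classical
  induction Q using Finset.induction_on with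
  | empty => exact ⟨c, 1, (one_smul S c).symm, by simp⟩
  | insert p Q _ ih =>
    obtain ⟨c', w, hc, ih⟩ := ih
    by_cases hp : p.1 • c ≤ p.2 • c
    · have hp' : (p.1 * w) • c' ≤ (p.2 * w) • c' := by rwa [mul_smul, mul_smul, ← hc]
      obtain ⟨c'', u, rfl, hu⟩ := hE _ _ _ hp'
      refine ⟨c'', w * u, by rw [hc, mul_smul], fun q hq hqc => ?_⟩
      rw [← mul_assoc, ← mul_assoc]
      rcases Finset.mem_insert.1 hq with rfl | hq
      · exact hu
      · exact mul_le_mul_left (ih q hq hqc) u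
    · refine ⟨c', w, hc, fun q hq hqc => ?_⟩
      rcases Finset.mem_insert.1 hq with rfl | hq
      · exact absurd hqc hp
      · exact ih q hq hqc

/-- A finite set of inequalities between multiples of elements of a locally cyclic part `K` lifts
to `S` along some element of `K`. -/
theorem CondE.exists_lift [MulRightMono S] {B : SPos S} (hE : CondE B) {K : Set B.carrier}
    (hne : K.Nonempty) (hK : ∀ (s : S) b, s • b ∈ K ↔ b ∈ K)
    (hdir : ∀ b ∈ K, ∀ b' ∈ K, ∃ (c : B.carrier) (s t : S), b = s • c ∧ b' = t • c)
    (F : Finset ((S × B.carrier) × (S × B.carrier))) :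
    ∃ (c : B.carrier) (r : B.carrier → S), ∀ q ∈ F, q.1.2 ∈ K → q.2.2 ∈ K →
      r q.1.2 • c = q.1.2 ∧ r q.2.2 • c = q.2.2 ∧
        (q.1.1 • q.1.2 ≤ q.2.1 • q.2.2 → q.1.1 * r q.1.2 ≤ q.2.1 * r q.2.2) := by
  classical
  obtain ⟨c, -, hc⟩ := exists_common_generator hne hK hdir
    (F.image (fun q => q.1.2) ∪ F.image fun q => q.2.2)
  -- The value `1` outside the relevant finite set is a dummy that makes `r` total.
  have hc' : ∀ b : B.carrier, ∃ s : S,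
      b ∈ F.image (fun q => q.1.2) ∪ F.image (fun q => q.2.2) → b ∈ K → s • c = b := by
    intro b
    by_cases hb : b ∈ F.image (fun q => q.1.2) ∪ F.image (fun q => q.2.2) ∧ b ∈ K
    · exact (hc b hb.1 hb.2).imp fun s hs _ _ => hs
    · exact ⟨1, fun h1 h2 => absurd ⟨h1, h2⟩ hb⟩
  choose r hr using hc'
  obtain ⟨c', w, rfl, hw⟩ := hE.exists_forall_mul_le c
    (F.image fun q => (q.1.1 * r q.1.2, q.2.1 * r q.2.2))
  refine ⟨c', fun b => r b * w, fun q hq h1 h2 => ?_⟩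
  have hr1 := hr q.1.2 (Finset.mem_union_left _ (Finset.mem_image_of_mem _ hq)) h1
  have hr2 := hr q.2.2 (Finset.mem_union_right _ (Finset.mem_image_of_mem _ hq)) h2
  refine ⟨by rw [mul_smul, hr1], by rw [mul_smul, hr2], fun hle => ?_⟩
  have := hw _ (Finset.mem_image_of_mem _ hq)
  rw [mul_smul, mul_smul, hr1, hr2, mul_assoc, mul_assoc] at this
  exact this hle

variable [MulLeftMono S] [MulRightMono S]

/-- If all ultrapowers of `S` are projective, a locally cyclic component of an `S`-poset
satisfying (E) is cyclic, and its elements have coordinates with respect to a generator. -/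
theorem CondE.exists_coord
    (h : ∀ (I : Type u) (D : Ultrafilter I), ultrapower S I D ∈ Pr S)
    {B : SPos S} (hE : CondE B) {K : Set B.carrier}
    (hne : K.Nonempty) (hK : ∀ (s : S) b, s • b ∈ K ↔ b ∈ K)
    (hdir : ∀ b ∈ K, ∀ b' ∈ K, ∃ (c : B.carrier) (s t : S), b = s • c ∧ b' = t • c) :
    ∃ (d : B.carrier) (ψ : B.carrier → S), (∀ b ∈ K, ψ b • d = b) ∧
      (∀ (s : S), ∀ b ∈ K, ψ (s • b) = s * ψ b) ∧ ∀ b ∈ K, ∀ b' ∈ K, b ≤ b' → ψ b ≤ ψ b' := by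
  choose g r hr using hE.exists_lift hne hK hdir
  let I := Finset ((S × B.carrier) × (S × B.carrier))
  let D : Ultrafilter I := Ultrafilter.of Filter.atTop
  have hev : ∀ q : (S × B.carrier) × (S × B.carrier), q.1.2 ∈ K → q.2.2 ∈ K →
      ∀ᶠ F in (D : Filter I), r F q.1.2 • g F = q.1.2 ∧ r F q.2.2 • g F = q.2.2 ∧
        (q.1.1 • q.1.2 ≤ q.2.1 • q.2.2 → q.1.1 * r F q.1.2 ≤ q.2.1 * r F q.2.2) := by
    intro q h1 h2
    have hq : ∀ᶠ F in (D : Filter I), {q} ≤ F :=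
      Ultrafilter.of_le Filter.atTop (Filter.eventually_ge_atTop _)
    exact hq.mono fun F hF => hr F q (hF (Finset.mem_singleton_self q)) h1 h2
  have hrg : ∀ b ∈ K, ∀ᶠ F in (D : Filter I), r F b • g F = b := fun b hb =>
    (hev ((1, b), (1, b)) hb hb).mono fun F hF => hF.1
  obtain ⟨co, gen, hco⟩ := exists_isCoord (h _ D)
  let φ : B.carrier → (ultrapower S I D).carrier := fun b => germ D fun F => r F b
  have hφ_le : ∀ (s : S) (b : B.carrier) (t : S) (b' : B.carrier), b ∈ K → b' ∈ K →
      s • b ≤ t • b' → s • φ b ≤ t • φ b' := fun s b t b' hb hb' hle =>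
    (hev ((s, b), (t, b')) hb hb').mono fun F hF => hF.2.2 hle
  have hφ_mono : ∀ b ∈ K, ∀ b' ∈ K, b ≤ b' → φ b ≤ φ b' := by
    intro b hb b' hb' hle
    simpa only [one_smul] using hφ_le 1 b 1 b' hb hb' (by simpa only [one_smul] using hle)
  have hφ_smul : ∀ (s : S), ∀ b ∈ K, φ (s • b) = s • φ b := by
    intro s b hb
    have hsb := (hK s b).2 hb
    -- Only inequalities are lifted, so equivariance comes from two opposite ones.
    apply le_antisymm
    · simpa only [one_smul] using hφ_le 1 _ s b hsb hb (one_smul S (s • b)).le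
    · simpa only [one_smul] using hφ_le s b 1 _ hb hsb (one_smul S (s • b)).ge
  let ψ : B.carrier → S := fun b => co (φ b)
  have hψ_smul : ∀ (s : S), ∀ b ∈ K, ψ (s • b) = s * ψ b := fun s b hb => by
    simp only [ψ, hφ_smul s b hb, hco.coeff_smul]
  have hψ_mono : ∀ b ∈ K, ∀ b' ∈ K, b ≤ b' → ψ b ≤ ψ b' := fun b hb b' hb' hle =>
    hco.coeff_mono _ _ (hφ_mono b hb b' hb' hle)
  obtain ⟨b₀, hb₀⟩ := hne
  have hgen : ∀ b ∈ K, gen (φ b) = gen (φ b₀) := by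
    intro b hb
    obtain ⟨c, s, t, rfl, rfl⟩ := hdir b hb b₀ hb₀
    have hc := (hK s c).1 hb
    rw [hφ_smul s c hc, hφ_smul t c hc, hco.gen_smul, hco.gen_smul]
  obtain ⟨c, hc⟩ := exists_germ (gen (φ b₀))
  -- Each `c F • g F` is a candidate generator, but the set of good `F` depends on `b`. This already
  -- shows that `ψ` is injective on `K`.
  have hψc : ∀ b ∈ K, ∀ᶠ F in (D : Filter I), ψ b • c F • g F = b := by
    intro b hb
    have h1 : ψ b • germ D c = φ b := by rw [hc, ← hgen b hb, hco.smul_gen]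
    filter_upwards [smul_germ_eq.1 h1, hrg b hb] with F hF hF'
    rw [← mul_smul, hF, hF']
  have hdK : ∀ b ∈ K, ∀ᶠ F in (D : Filter I), c F • g F ∈ K := fun b hb =>
    (hψc b hb).mono fun F hF => (hK (ψ b) _).1 (by rwa [hF])
  have hψψ : ∀ b ∈ K, ∀ᶠ F in (D : Filter I), ψ b * ψ (c F • g F) = ψ b := by
    intro b hb
    filter_upwards [hψc b hb, hdK b hb] with F hF hF'
    rw [← hψ_smul _ _ hF', hF]
  -- Almost all candidates have the same coefficient `v`, so one `F₀` serves every `b`: `ψ b • c F₀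
  -- • g F₀` and `b` have the same image under `ψ`.
  obtain ⟨v, hv⟩ := eventually_const_of_smul_eq h _ _ (hψψ b₀ hb₀)
  obtain ⟨F₀, hF₀, hF₀K⟩ := (hv.and (hdK b₀ hb₀)).exists
  refine ⟨c F₀ • g F₀, ψ, fun b hb => ?_, hψ_smul, hψ_mono⟩
  have hψv : ψ b * v = ψ b := by
    obtain ⟨F, h1, h2⟩ := (hv.and (hψψ b hb)).exists
    rwa [h1] at h2
  have hb' : ψ b • c F₀ • g F₀ ∈ K := (hK _ _).2 hF₀K
  have heq : ψ (ψ b • c F₀ • g F₀) = ψ b := by rw [hψ_smul _ _ hF₀K, hF₀, hψv]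
  obtain ⟨F, h1, h2⟩ := ((hψc _ hb').and (hψc b hb)).exists
  rw [← h1, heq, h2]

theorem SF_subset_Pr_of_ultrapower
    (h : ∀ (I : Type u) (D : Ultrafilter I), ultrapower S I D ∈ Pr S) : SF S ⊆ Pr S := by
  rintro B ⟨hP, hE⟩
  let r : Setoid B.carrier :=
    { r := fun b b' => ∃ (c : B.carrier) (s t : S), b = s • c ∧ b' = t • c
      iseqv :=
        { refl := fun b => ⟨b, 1, 1, (one_smul S b).symm, (one_smul S b).symm⟩
          symm := fun ⟨c, s, t, h1, h2⟩ => ⟨c, t, s, h2, h1⟩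
          trans := by
            rintro a b b' ⟨c, s, t, rfl, h1⟩ ⟨d, s', t', h2, rfl⟩
            -- (P) merges the two common divisors `c` and `d` into one.
            obtain ⟨e, w, w', rfl, rfl, -⟩ := hP c d t s' (h1.symm.trans h2).le
            exact ⟨e, s * w, t' * w', (mul_smul _ _ _).symm, (mul_smul _ _ _).symm⟩ } }
  have hsmul : ∀ (s : S) b, r (s • b) b := fun s b => ⟨b, s, 1, rfl, (one_smul S b).symm⟩
  have hle : ∀ b b' : B.carrier, b ≤ b' → r b b' := by
    intro b b' hb
    obtain ⟨c, s, t, h1, h2, -⟩ := hP b b' 1 1 (by simpa only [one_smul] using hb)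
    exact ⟨c, s, t, h1, h2⟩
  have key : ∀ x : B.carrier, ∃ (d : B.carrier) (ψ : B.carrier → S),
      (∀ b, r b x → ψ b • d = b) ∧ (∀ (s : S) b, r b x → ψ (s • b) = s * ψ b) ∧
        ∀ b, r b x → ∀ b', r b' x → b ≤ b' → ψ b ≤ ψ b' := fun x =>
    hE.exists_coord h (K := {b | r b x}) ⟨x, r.refl x⟩
      (fun s b => ⟨fun hb => r.trans (r.symm (hsmul s b)) hb, fun hb => r.trans (hsmul s b) hb⟩)
      (fun b hb b' hb' => r.trans hb (r.symm hb'))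
  choose d ψ h1 h2 h3 using key
  -- `d` and `ψ` were chosen per base point; one representative per component makes them agree on
  -- it.
  let rep : B.carrier → B.carrier := fun b => (Quotient.mk r b).out
  have hrep : ∀ b, r b (rep b) := fun b => r.symm (Quotient.mk_out (s := r) b)
  have hrep_eq : ∀ b b', r b b' → rep b = rep b' := fun b b' hb =>
    congrArg Quotient.out (Quotient.sound (s := r) hb)
  have hcoord : IsCoord B (fun b => ψ (rep b) b) (fun b => d (rep b)) :=
    { smul_gen := fun b => h1 _ b (hrep b)
      coeff_smul := fun s b => by
        rw [hrep_eq _ _ (hsmul s b), h2 _ s b (hrep b)]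
      gen_smul := fun s b => by rw [hrep_eq _ _ (hsmul s b)]
      coeff_mono := fun b b' hb => by
        have hbb' := hrep_eq _ _ (hle b b' hb)
        rw [hbb']
        exact h3 _ b (hbb' ▸ hrep b) b' (hrep b') hb
      gen_eq := fun b b' hb => by rw [hrep_eq _ _ (hle b b' hb)] }
  exact hcoord.mem_Pr

end SPos

theorem theorem6p1 (S : Type u) [Monoid S] [PartialOrder S] [MulLeftMono S] [MulRightMono S] :
    List.TFAE [
      SPos.Axiomatisable (SPos.Pr S),
      ∀ (I : Type u) (D : Ultrafilter I), SPos.ultrapower S I D ∈ SPos.Pr S,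
      SPos.Axiomatisable (SPos.SF S) ∧ SPos.SF S = SPos.Pr S] := by
  tfae_have 1 → 2 := fun h I D => SPos.ultrapower_mem_of_axiomatisable h SPos.regular_mem_Pr
  tfae_have 2 → 3 := fun h =>
    ⟨SPos.axiomatisable_SF_of_finGen
      (SPos.finGenPairs_of_ultrapower fun I D => (SPos.Pr_subset_SF (h I D)).1)
      (SPos.finGenIdeals_of_ultrapower fun I D => (SPos.Pr_subset_SF (h I D)).2),
    (SPos.SF_subset_Pr_of_ultrapower h).antisymm SPos.Pr_subset_SF⟩
  tfae_have 3 → 1 := fun h => h.2 ▸ h.1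
  tfae_finish
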